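/- Let $k,p\ge 1$ be integers and let $C_1,\dots,C_p\in\mathbb{R}^k$. Let $\tau_1,\dots,\tau_k>0$ be pairwise distinct real numbers, and let $\omega_1,\dots,\omega_k,\varphi_1,\dots,\varphi_k$ be real numbers such that there exist infinitely many integers $n$ with the following property: for every $j\in\{1,\dots,k\}$, $n\omega_j+\varphi_j\not\equiv\frac{\pi}{2}\bmod\pi$. Let $(Q_n)_{n\ge1}$ be a (strictly) increasing sequence of positive integers such that, as $n\to\infty$, $Q_{n+1}=Q_n^{1+O(1/n)}$; if $\omega_1=\dots=\omega_k=0$, this assumption can be weakened to $Q_{n+1}=Q_n^{1+o(1)}$. For every $n\ge1$ let $\ell_{1,n},\dots,\ell_{p,n}\in\mathbb{Z}$ be such that, as $n\to\infty$, $$\max_{1\le i\le p}|\ell_{i,n}|\le Q_n^{1+o(1)}$$ and, for every $j\in\{1,\dots,k\}$, the $j$-th coordinate of $\ell_{1,n}C_1+\dots+\ell_{p,n}C_p$ is equal to $$\pm Q_n^{-\tau_j+o(1)}\bigl(\cos(n\omega_j+\varphi_j)+o(1)\bigr),$$ where the signs $\pm$ may depend on $n$ and $j$. Then: (i) $\mathrm{rk}_{\mathbb{Q}}(C_1,\dots,C_p)\ge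 k+\tau_1+\dots+\tau_k$, where $\mathrm{rk}_{\mathbb{Q}}(C_1,\dots,C_p)$ is the rank of the family $C_1,\dots,C_p$ in $\mathbb{R}^k$ considered as a $\mathbb{Q}$-vector space. (ii) For every non-zero ($\mathbb{R}$-)linear form $\chi:\mathbb{R}^k\to\mathbb{R}$ there exists $i\in\{1,\dots,p\}$ such that $\chi(C_i)\notin\mathbb{Q}$. (iii) Let $\varepsilon>0$, and let the real number $Q$ be sufficiently large in terms of $\varepsilon$ (and of the data fixed above). Let $\lambda_1,\dots,\lambda_k\in\mathbb{R}$, not all zero, be such that $|\lambda_j|\le Q^{\tau_j}$ for every $j\in\{1,\dots,k\}$, and let $\chi(x_1,\dots,x_k)=\lambda_1x_1+\dots+\lambda_kx_k$. Then $$\mathrm{dist}\Bigl((\chi(C_1),\dots,\chi(C_p)),\ \mathbb{Z}^p\setminus\{(0,\dots,0)\}\Bigr)\ge Q^{-1-\varepsilon},$$ where $\mathrm{dist}(y,\mathbb{Z}^p\setminus\{(0,\dots,0)\})$ is the minimal Euclidean distance of $y\in\mathbb{R}^p$ to a non-zero integer point. -/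

import Mathlib

open Filter Topology

/-- The set of the non-zero integer points of `ℝ^p`, where `ℝ^p` carries the Euclidean norm. -/
def nonzeroIntPoints (p : ℕ) : Set (EuclideanSpace ℝ (Fin p)) :=
  {x | x ≠ 0 ∧ ∀ i, ∃ m : ℤ, x i = (m : ℝ)}

/-!
Write `L_ℓ(P) = ∑ i, ℓ i * P i` and let `e j = (C i j)_i`, so that the `j`-th coordinate of
`∑ i, ℓ i • C i` is `L_ℓ (e j)`. The hypotheses enter only through `HasSmallForms C τ`: at every
large enough height `exp x` there is an integer form `L_ℓ` with coefficients at most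
`exp ((1 + o(1)) x)` and `|L_ℓ (e j)| = exp ((-τ j + o(1)) x)` for all `j`.

This holds (`hasSmallForms_of_oscillating`) because a single `n₀` at which none of the cosines
vanishes gives, by recurrence of the rotation `n ↦ (exp (i n ω j))_j` on a torus, a set of indices
with bounded gaps on which all the cosines are bounded away from `0`. As
`Q (n + 1) = Q n ^ (1 + o(1))` survives boundedly many iterations, the heights `Q n` with `n` in
that set still meet every interval `[X, X ^ (1 + δ)]` with `X` large, and the cosines are absorbed
in the factor `Q n ^ o(1)`. Both growth conditions enter through `Q (n + 1) = Q n ^ (1 + o(1))`.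

The distance estimate (`HasSmallForms.eventually_le`) goes as follows. Suppose that the integer
point `P` is closer than `exp (-(1 + ε) s)` to `∑ j, lam j • e j`, where `|lam j| ≤ exp (τ j * s)`
with equality for some `j`. As the `τ j` are distinct, the functions `log |lam j| - τ j * x` of
`x` are affine with distinct slopes, so there are boundedly many values of `x` at which two of
them agree; hence one can choose `x` slightly larger than `s`, at distance at least a constant
multiple of `s` from all these values. At this height one term of `∑ j, lam j * L_ℓ (e j)`
dominates the others: the sum is less than `1` and not `0`, and it exceeds the error
`|L_ℓ (P - ∑ j, lam j • e j)|`. So the integer `L_ℓ P` would lie strictly between `0` and `1` in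
absolute value. For `lam` in a bounded set a compactness argument reduces the estimate to the fact
that `∑ j, lam j • e j` is never an integer point for `lam ≠ 0`
(`HasSmallForms.exists_ne_intCast`), which also yields the irrationality statement.

For the rank, one replaces `C` by a `ℤ`-basis of the subgroup it generates, which preserves
`HasSmallForms`, and is left with the claim that the number of vectors is at least `k + ∑ j, τ j`
(`HasSmallForms.card_add_sum_le`). The `e j` are linearly independent; extend them to a basis.
Minkowski's theorem for the box of side lengths about `exp (τ j * s)` along `e j` and
`exp (-(1 + ε) s)` along the other directions would produce an integer point that contradicts the
distance estimate, unless the volume of the box stays bounded as `s` tends to infinity.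
-/

/-! ### Elementary estimates -/

lemma exists_pos_forall_le {α : Type*} [Finite α] (f : α → ℝ) (hf : ∀ a, 0 < f a) :
    ∃ c, 0 < c ∧ ∀ a, c ≤ f a := by
  cases nonempty_fintype α
  rcases isEmpty_or_nonempty α with h | h
  · exact ⟨1, one_pos, fun a => h.elim a⟩
  · obtain ⟨a, ha⟩ := Finite.exists_min f
    exact ⟨f a, hf a, ha⟩

lemma exists_pos_forall_le_abs_sub {κ : Type*} [Finite κ] {τ : κ → ℝ}
    (hτ : Function.Injective τ) :
    ∃ σ, 0 < σ ∧ ∀ i j, i ≠ j → σ ≤ |τ i - τ j| := by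
  obtain ⟨σ, h0, h⟩ := exists_pos_forall_le
    (fun q : {q : κ × κ // q.1 ≠ q.2} => |τ q.1.1 - τ q.1.2|)
    (fun q => abs_pos.2 (sub_ne_zero.2 fun h => q.2 (hτ h)))
  exact ⟨σ, h0, fun i j hij => h ⟨(i, j), hij⟩⟩

/-- A sum with one dominating term is at least half as large as that term. -/
lemma half_abs_le_abs_sum {κ : Type*} [Fintype κ] (v : κ → ℝ) (j₀ : κ)
    (h : ∀ j, j ≠ j₀ → Fintype.card κ * |v j| ≤ |v j₀| / 2) :
    |v j₀| / 2 ≤ |∑ j, v j| := by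
  classical
  have hk : (0 : ℝ) < Fintype.card κ := by
    exact_mod_cast Fintype.card_pos_iff.2 ⟨j₀⟩
  have hrest : |∑ j ∈ Finset.univ.erase j₀, v j| ≤ |v j₀| / 2 := by
    calc |∑ j ∈ Finset.univ.erase j₀, v j| ≤ ∑ j ∈ Finset.univ.erase j₀, |v j| :=
          Finset.abs_sum_le_sum_abs _ _
      _ ≤ ∑ j ∈ Finset.univ.erase j₀, |v j₀| / 2 / Fintype.card κ :=
          Finset.sum_le_sum fun j hj => by
            rw [le_div_iff₀ hk, mul_comm]
            exact h j (Finset.ne_of_mem_erase hj)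
      _ ≤ ∑ _j : κ, |v j₀| / 2 / Fintype.card κ :=
          Finset.sum_le_sum_of_subset_of_nonneg (Finset.erase_subset _ _)
            fun _ _ _ => by positivity
      _ = |v j₀| / 2 := by
          rw [Finset.sum_const, Finset.card_univ, nsmul_eq_mul]
          field_simp
  rw [← Finset.add_sum_erase _ _ (Finset.mem_univ j₀)]
  have h1 := abs_sub_abs_le_abs_sub (v j₀) (-∑ j ∈ Finset.univ.erase j₀, v j)
  rw [abs_neg, sub_neg_eq_add] at h1
  linarith

/-- A finite set leaves a gap of half-width `h` in any interval of length
`2 * (F.card + 1) * h`. -/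
lemma exists_mem_Icc_forall_le_abs_sub (F : Finset ℝ) (a : ℝ) {h : ℝ} (hh : 0 < h) :
    ∃ x ∈ Set.Icc a (a + 2 * (F.card + 1) * h), ∀ f ∈ F, h ≤ |x - f| := by
  -- Each `f` is closer than `h` to at most one of the midpoints of the `F.card + 1` consecutive
  -- intervals of length `2 * h`.
  by_contra! hc
  have hmem : ∀ m ∈ Finset.range (F.card + 1), a + (2 * (m : ℝ) + 1) * h ∈
      Set.Icc a (a + 2 * (F.card + 1) * h) := by
    intro m hm
    have hm' : (m : ℝ) ≤ F.card := by
      exact_mod_cast Nat.lt_succ_iff.1 (Finset.mem_range.1 hm)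
    constructor
    · have : 0 ≤ (2 * (m : ℝ) + 1) * h := by positivity
      linarith
    · nlinarith
  choose! g hgF hg using fun (m : ℕ) hm => hc _ (hmem m hm)
  obtain ⟨m, hm, n, hn, hne, heq⟩ := Finset.exists_ne_map_eq_of_card_lt_of_maps_to
    (by simp : F.card < (Finset.range (F.card + 1)).card) hgF
  have h1 := abs_lt.1 (hg m hm)
  have h2 := abs_lt.1 (hg n hn)
  rw [← heq] at h2
  rcases lt_or_gt_of_ne hne with hlt | hlt
  · have : (m : ℝ) + 1 ≤ n := by exact_mod_cast hlt
    nlinarith [h1.1, h1.2, h2.1, h2.2]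
  · have : (n : ℝ) + 1 ≤ m := by exact_mod_cast hlt
    nlinarith [h1.1, h1.2, h2.1, h2.2]

lemma eventually_mul_exp_neg_le (A : ℝ) {c δ : ℝ} (hc : 0 < c) (hδ : 0 < δ) :
    ∀ᶠ x : ℝ in atTop, A * Real.exp (-c * x) ≤ δ := by
  have h : Tendsto (fun x : ℝ => A * Real.exp (-c * x)) atTop (𝓝 (A * 0)) := by
    refine Tendsto.const_mul _ (Real.tendsto_exp_atBot.comp ?_)
    exact tendsto_id.const_mul_atTop_of_neg (by linarith)
  rw [mul_zero] at h
  exact (h.eventually (gt_mem_nhds hδ)).mono fun _ hx => hx.le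

/-! ### Integer linear forms that are small at several points -/

/-- At every height `exp x` with `x` large, some linear form with integer coefficients `ℓ` of size
at most `exp ((1 + o(1)) x)` takes values of exact order `exp ((-τ j + o(1)) x)` at the points
`(C i j)_i`, for all `j` at once. The terms `o(1)` are encoded by a constant `ε`, arbitrarily
small, which bounds all of them. -/
def HasSmallForms {ι κ : Type*} [Fintype ι] (C : ι → κ → ℝ) (τ : κ → ℝ) : Prop :=
  ∀ ε : ℝ, 0 < ε → ∀ᶠ x : ℝ in atTop, ∃ ℓ : ι → ℤ,
    (∀ i, |(ℓ i : ℝ)| ≤ Real.exp ((1 + ε) * x)) ∧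
    ∀ j, Real.exp (-(τ j + ε) * x) ≤ |∑ i, (ℓ i : ℝ) * C i j| ∧
      |∑ i, (ℓ i : ℝ) * C i j| ≤ Real.exp (-(τ j - ε) * x)

lemma sum_mul_sum_eq {ι κ : Type*} [Fintype ι] [Fintype κ] (C : ι → κ → ℝ) (a : ι → ℝ)
    (lam : κ → ℝ) :
    ∑ i, a i * ∑ j, lam j * C i j = ∑ j, lam j * ∑ i, a i * C i j := by
  simp only [Finset.mul_sum]
  rw [Finset.sum_comm]
  exact Finset.sum_congr rfl fun j _ => Finset.sum_congr rfl fun i _ => by ring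

/-- A non-trivial real combination of the points `(C i j)_i` is not an integer point: at large
height the term with the smallest exponent `τ j` dominates, so that the integer form of
`HasSmallForms` would take a non-zero integer value of absolute value less than `1`. The integer
point `P = 0` is allowed, so this contains the linear independence of these points. -/
theorem HasSmallForms.exists_ne_intCast {ι κ : Type*} [Fintype ι] [Fintype κ] {C : ι → κ → ℝ}
    {τ : κ → ℝ} (H : HasSmallForms C τ) (hpos : ∀ j, 0 < τ j) (hinj : Function.Injective τ)
    {lam : κ → ℝ} (hlam : lam ≠ 0) (P : ι → ℤ) : ∃ i, ∑ j, lam j * C i j ≠ P i := by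
  by_contra! hP
  obtain ⟨σ, hσ, hσ'⟩ := exists_pos_forall_le_abs_sub hinj
  obtain ⟨m, hm, hm'⟩ := exists_pos_forall_le τ hpos
  obtain ⟨j₀, hj₀, hmin⟩ : ∃ j₀, lam j₀ ≠ 0 ∧ ∀ j, lam j ≠ 0 → τ j₀ ≤ τ j := by
    obtain ⟨j, hj⟩ := Function.ne_iff.1 hlam
    classical
    obtain ⟨j₀, h1, h2⟩ := Finset.exists_min_image (Finset.univ.filter fun j => lam j ≠ 0) τ
      ⟨j, by simpa using hj⟩
    exact ⟨j₀, by simpa using h1, fun j hj => h2 j (by simpa using hj)⟩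
  -- `σ / 4` makes the term of `j₀` dominate, `m / 2` makes all the terms tend to `0`.
  set ε := min (σ / 4) (m / 2) with hε
  have hε0 : 0 < ε := by positivity
  have hε1 : ε ≤ σ / 4 := min_le_left _ _
  have hε2 : ε ≤ m / 2 := min_le_right _ _
  have hlam0 : 0 < |lam j₀| := abs_pos.2 hj₀
  have e1 : ∀ᶠ x : ℝ in atTop, ∀ j,
      Fintype.card κ * |lam j| * Real.exp (-(σ / 2) * x) ≤ |lam j₀| / 2 :=
    eventually_all.2 fun j => eventually_mul_exp_neg_le _ (by positivity) (by positivity)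
  have e2 : ∀ᶠ x : ℝ in atTop, (∑ j, |lam j|) * Real.exp (-(m / 2) * x) ≤ 1 / 2 :=
    eventually_mul_exp_neg_le _ (by positivity) (by positivity)
  obtain ⟨x, ⟨ℓ, -, hℓ⟩, h1, h2, hx⟩ :=
    ((H ε hε0).and (e1.and (e2.and (eventually_ge_atTop 0)))).exists
  set v : κ → ℝ := fun j => lam j * ∑ i, (ℓ i : ℝ) * C i j with hv
  have hsum : ∑ j, v j = ((∑ i, ℓ i * P i : ℤ) : ℝ) := by
    rw [hv, ← sum_mul_sum_eq]
    push_cast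
    exact Finset.sum_congr rfl fun i _ => by rw [hP]
  have hlow : 0 < |∑ j, v j| := by
    have hv0 : |lam j₀| * Real.exp (-(τ j₀ + ε) * x) ≤ |v j₀| := by
      rw [hv, abs_mul]
      exact mul_le_mul_of_nonneg_left (hℓ j₀).1 hlam0.le
    refine lt_of_lt_of_le ?_ (half_abs_le_abs_sum v j₀ fun j hj => ?_)
    · have := hv0.trans_lt' (by positivity)
      positivity
    by_cases hj0 : lam j = 0
    · simp only [hv, hj0, zero_mul, abs_zero, mul_zero]
      positivity
    have hτj : τ j₀ + σ ≤ τ j := by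
      have h3 := hσ' j j₀ hj
      rw [abs_of_nonneg (sub_nonneg.2 (hmin j hj0))] at h3
      linarith
    calc (Fintype.card κ : ℝ) * |v j|
        ≤ Fintype.card κ * (|lam j| * Real.exp (-(τ j - ε) * x)) := by
          rw [hv, abs_mul]
          gcongr
          exact (hℓ j).2
      _ ≤ Fintype.card κ * (|lam j| *
            (Real.exp (-(σ / 2) * x) * Real.exp (-(τ j₀ + ε) * x))) := by
          rw [← Real.exp_add]
          gcongr
          nlinarith
      _ = (Fintype.card κ * |lam j| * Real.exp (-(σ / 2) * x)) *
            Real.exp (-(τ j₀ + ε) * x) := by ring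
      _ ≤ |lam j₀| / 2 * Real.exp (-(τ j₀ + ε) * x) := by
          gcongr
          exact h1 j
      _ ≤ |v j₀| / 2 := by linarith
  have hup : |∑ j, v j| < 1 := by
    calc |∑ j, v j| ≤ ∑ j, |v j| := Finset.abs_sum_le_sum_abs _ _
      _ ≤ ∑ j, |lam j| * Real.exp (-(m / 2) * x) := by
          refine Finset.sum_le_sum fun j _ => ?_
          rw [hv, abs_mul]
          refine mul_le_mul_of_nonneg_left ((hℓ j).2.trans (Real.exp_le_exp.2 ?_)) (abs_nonneg _)
          nlinarith [hm' j]
      _ < 1 := by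
          rw [← Finset.sum_mul]
          linarith
  rw [hsum] at hlow hup
  rw [← Int.cast_abs] at hlow hup
  have h3 : 0 < |∑ i, ℓ i * P i| := by exact_mod_cast hlow
  have h4 : |∑ i, ℓ i * P i| < 1 := by exact_mod_cast hup
  omega

/-- The functions `log a - t * x` and `log b - u * x` of `x` differ by `|t - u|` times the
distance of `x` to the point where they agree. The case `a = 0` is included, where `Real.log a` is
a junk value but the conclusion is trivial. -/
lemma mul_exp_le_of_abs_sub_crossing {a b t u x D : ℝ} (ha : 0 ≤ a) (hb : 0 < b) (htu : t ≠ u)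
    (hle : a * Real.exp (-t * x) ≤ b * Real.exp (-u * x))
    (hD : D ≤ |t - u| * |x - (Real.log a - Real.log b) / (t - u)|) :
    a * Real.exp (-t * x) ≤ b * Real.exp (-u * x) * Real.exp (-D) := by
  rcases ha.eq_or_lt with rfl | ha
  · rw [zero_mul]
    positivity
  have ea : a * Real.exp (-t * x) = Real.exp (Real.log a - t * x) := by
    rw [sub_eq_add_neg, Real.exp_add, Real.exp_log ha, neg_mul]
  have eb : b * Real.exp (-u * x) = Real.exp (Real.log b - u * x) := by
    rw [sub_eq_add_neg, Real.exp_add, Real.exp_log hb, neg_mul]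
  rw [ea, eb, Real.exp_le_exp] at hle
  rw [ea, eb, ← Real.exp_add, Real.exp_le_exp]
  have h : |t - u| * |x - (Real.log a - Real.log b) / (t - u)| =
      |(Real.log a - t * x) - (Real.log b - u * x)| := by
    rw [← abs_mul, mul_sub, mul_div_cancel₀ _ (sub_ne_zero.2 htu), ← abs_neg]
    congr 1
    ring
  rw [h, abs_of_nonpos (by linarith)] at hD
  linarith

set_option maxHeartbeats 1000000 in
/-- The distance estimate for coefficients `lam` that reach the bound `exp (τ j * s)` for some
`j`. The form is evaluated at a height `exp x` with `(1 + η) * s ≤ x ≤ (1 + 2 * η) * s`: then all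
terms `lam j * exp (-τ j * x)` are small, but the largest one is at least
`exp (-2 * η * T * s)`. -/
theorem HasSmallForms.eventually_le_of_eq {ι κ : Type*} [Fintype ι] [Fintype κ] {C : ι → κ → ℝ}
    {τ : κ → ℝ} (H : HasSmallForms C τ) (hpos : ∀ j, 0 < τ j) (hinj : Function.Injective τ)
    {ε : ℝ} (hε : 0 < ε) :
    ∀ᶠ s : ℝ in atTop, ∀ lam : κ → ℝ, (∀ j, |lam j| ≤ Real.exp (τ j * s)) →
      (∃ j, |lam j| = Real.exp (τ j * s)) → ∀ P : ι → ℤ,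
        ∃ i, Real.exp (-(1 + ε) * s) ≤ |P i - ∑ j, lam j * C i j| := by
  classical
  obtain ⟨σ, hσ, hσ'⟩ := exists_pos_forall_le_abs_sub hinj
  obtain ⟨m, hm, hm'⟩ := exists_pos_forall_le τ hpos
  obtain ⟨t, ht⟩ : ∃ t, ∀ j, τ j ≤ t := ⟨∑ j, τ j, fun j =>
    Finset.single_le_sum (fun j _ => (hpos j).le) (Finset.mem_univ j)⟩
  set K : ℝ := (Fintype.card (κ × κ) : ℝ) with hK
  have hK0 : 0 ≤ K := Nat.cast_nonneg _
  set T := max t 0 with hT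
  have hT0 : 0 ≤ T := le_max_right _ _
  have htT : ∀ j, τ j ≤ T := fun j => (ht j).trans (le_max_left _ _)
  -- `η` is the relative width of the window for `x`, chosen so that the loss
  -- `(2 + 2 * T) * η` is at most half of the gain `ε`.
  set η := min (1 / 2) (ε / (4 * (T + 1))) with hη
  have hη0 : 0 < η := by positivity
  have hη1 : η ≤ 1 / 2 := min_le_left _ _
  have hη2 : η * (2 + 2 * T) ≤ ε / 2 := by
    have : η ≤ ε / (4 * (T + 1)) := min_le_right _ _
    rw [le_div_iff₀ (by positivity)] at this
    linarith
  set h₁ := η / (2 * (K + 1)) with hh₁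
  have hh₁0 : 0 < h₁ := by positivity
  -- `δ` is the error in the exponents; it has to be small compared with the separation `σ * h₁` of
  -- the terms, with their decay `m * η`, and with `ε`.
  set δ := min (σ * h₁ / 5) (min (m * η / 3) (ε / 10)) with hδ
  have hδ0 : 0 < δ := by positivity
  have hδ1 : δ ≤ σ * h₁ / 5 := min_le_left _ _
  have hδ2 : δ ≤ m * η / 3 := (min_le_right _ _).trans (min_le_left _ _)
  have hδ3 : δ ≤ ε / 10 := (min_le_right _ _).trans (min_le_right _ _)
  have hlin : Tendsto (fun s : ℝ => (1 + η) * s) atTop atTop :=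
    tendsto_id.const_mul_atTop (by positivity)
  have e1 : ∀ᶠ s : ℝ in atTop, (Fintype.card κ : ℝ) * Real.exp (-δ * s) ≤ 1 / 4 :=
    eventually_mul_exp_neg_le _ hδ0 (by norm_num)
  have e2 : ∀ᶠ s : ℝ in atTop, (Fintype.card ι : ℝ) * Real.exp (-δ * s) ≤ 1 / 4 :=
    eventually_mul_exp_neg_le _ hδ0 (by norm_num)
  have e3 := hlin.eventually (eventually_forall_ge_atTop.2 (H δ hδ0))
  filter_upwards [e1, e2, e3, eventually_gt_atTop 0] with s he1 he2 he3 hs lam hlam hex P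
  by_contra! hclose
  -- The points of `F` are those where two terms agree; for `τ q.1 = τ q.2` or a vanishing
  -- coefficient they are junk values, which do no harm.
  set F : Finset ℝ := (Finset.univ : Finset (κ × κ)).image
    fun q => (Real.log |lam q.1| - Real.log |lam q.2|) / (τ q.1 - τ q.2) with hF
  have hFK : (F.card : ℝ) ≤ K := by
    rw [hK]
    exact_mod_cast Finset.card_image_le
  obtain ⟨x, ⟨hx1, hx2⟩, hxF⟩ :=
    exists_mem_Icc_forall_le_abs_sub F ((1 + η) * s) (mul_pos hh₁0 hs)
  have hx3 : x ≤ (1 + 2 * η) * s := by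
    have h1 : 2 * ((F.card : ℝ) + 1) * (h₁ * s) ≤ 2 * (K + 1) * (h₁ * s) := by gcongr
    have h2 : 2 * (K + 1) * (h₁ * s) = η * s := by
      rw [hh₁]
      field_simp
    linarith
  have hx4 : x ≤ 2 * s := hx3.trans (by nlinarith)
  have hx0 : 0 < x := lt_of_lt_of_le (by positivity) hx1
  obtain ⟨ℓ, hℓ, hℓC⟩ := he3 x hx1
  obtain ⟨j₁, hj₁⟩ := hex
  obtain ⟨j₀, -, hj₀⟩ := Finset.exists_max_image Finset.univ
    (fun j => |lam j| * Real.exp (-τ j * x)) ⟨j₁, Finset.mem_univ _⟩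
  set E := |lam j₀| * Real.exp (-τ j₀ * x) with hE
  have hElow : Real.exp (-(2 * η * T) * s) ≤ E := by
    refine le_trans ?_ (hj₀ j₁ (Finset.mem_univ _))
    rw [hj₁, ← Real.exp_add]
    refine Real.exp_le_exp.2 ?_
    have h1 : τ j₁ * (x - s) ≤ T * (2 * η * s) :=
      mul_le_mul (htT j₁) (by linarith) (by nlinarith) hT0
    linarith
  have hE0 : 0 < E := (Real.exp_pos _).trans_le hElow
  have hlam0 : 0 < |lam j₀| := by
    by_contra hcon
    have : |lam j₀| = 0 := le_antisymm (not_lt.1 hcon) (abs_nonneg _)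
    rw [hE, this, zero_mul] at hE0
    exact lt_irrefl _ hE0
  set v : κ → ℝ := fun j => lam j * ∑ i, (ℓ i : ℝ) * C i j with hv
  have hvle : ∀ j, |v j| ≤ |lam j| * Real.exp (-τ j * x) * Real.exp (δ * x) := by
    intro j
    rw [hv, abs_mul, mul_assoc, ← Real.exp_add]
    refine mul_le_mul_of_nonneg_left ((hℓC j).2.trans (Real.exp_le_exp.2 ?_)) (abs_nonneg _)
    linarith
  have hv0 : E * Real.exp (-δ * x) ≤ |v j₀| := by
    rw [hv, abs_mul, hE, mul_assoc, ← Real.exp_add]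
    refine mul_le_mul_of_nonneg_left (le_trans (Real.exp_le_exp.2 ?_) (hℓC j₀).1) (abs_nonneg _)
    linarith
  have hδx : δ * x ≤ 2 * δ * s := by nlinarith
  have hgap : ∀ j, j ≠ j₀ → |lam j| * Real.exp (-τ j * x) ≤ E * Real.exp (-(σ * h₁) * s) := by
    intro j hj
    have h1 := hxF _ (Finset.mem_image_of_mem _ (Finset.mem_univ (j, j₀)))
    have h2 : σ * h₁ * s ≤ |τ j - τ j₀| *
        |x - (Real.log |lam j| - Real.log |lam j₀|) / (τ j - τ j₀)| := by
      rw [mul_assoc]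
      exact mul_le_mul (hσ' j j₀ hj) h1 (by positivity) (abs_nonneg _)
    refine (mul_exp_le_of_abs_sub_crossing (abs_nonneg _) hlam0 (fun h => hj (hinj h))
      (hj₀ j (Finset.mem_univ _)) h2).trans_eq ?_
    rw [hE, neg_mul (σ * h₁)]
  -- The sum `∑ j, v j` is small but not too small, and the integer `∑ i, ℓ i * P i` is close to it.
  have hlow : E * Real.exp (-δ * x) / 2 ≤ |∑ j, v j| := by
    refine le_trans ?_ (half_abs_le_abs_sum v j₀ fun j hj => ?_)
    · linarith
    calc (Fintype.card κ : ℝ) * |v j|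
        ≤ Fintype.card κ * (E * Real.exp (-(σ * h₁) * s) * Real.exp (δ * x)) := by
          gcongr
          exact (hvle j).trans (mul_le_mul_of_nonneg_right (hgap j hj) (Real.exp_pos _).le)
      _ ≤ Fintype.card κ * (E * (Real.exp (-δ * s) * Real.exp (-δ * x))) := by
          rw [mul_assoc, ← Real.exp_add, ← Real.exp_add]
          refine mul_le_mul_of_nonneg_left (mul_le_mul_of_nonneg_left
            (Real.exp_le_exp.2 ?_) hE0.le) (Nat.cast_nonneg _)
          have := mul_le_mul_of_nonneg_right hδ1 hs.le
          linarith
      _ = (Fintype.card κ * Real.exp (-δ * s)) * (E * Real.exp (-δ * x)) := by ring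
      _ ≤ 1 / 4 * (E * Real.exp (-δ * x)) := by gcongr
      _ ≤ |v j₀| / 2 := by
          have : 0 < E * Real.exp (-δ * x) := by positivity
          linarith
  have hup : |∑ j, v j| ≤ 1 / 4 := by
    calc |∑ j, v j| ≤ ∑ j, |v j| := Finset.abs_sum_le_sum_abs _ _
      _ ≤ ∑ _j : κ, Real.exp (-δ * s) := by
          refine Finset.sum_le_sum fun j _ => (hvle j).trans ?_
          calc |lam j| * Real.exp (-τ j * x) * Real.exp (δ * x)
              ≤ Real.exp (τ j * s) * Real.exp (-τ j * x) * Real.exp (δ * x) := by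
                gcongr
                exact hlam j
            _ ≤ Real.exp (-δ * s) := by
                rw [← Real.exp_add, ← Real.exp_add, Real.exp_le_exp]
                have : m * (η * s) ≤ τ j * (x - s) :=
                  mul_le_mul (hm' j) (by linarith) (by positivity) (hpos j).le
                nlinarith
      _ = Fintype.card κ * Real.exp (-δ * s) := by
          rw [Finset.sum_const, Finset.card_univ, nsmul_eq_mul]
      _ ≤ 1 / 4 := he1
  have herr : |(∑ i, (ℓ i : ℝ) * P i) - ∑ j, v j| ≤ 1 / 4 * (E * Real.exp (-δ * x)) := by
    rw [hv, ← sum_mul_sum_eq, ← Finset.sum_sub_distrib]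
    calc |∑ i, ((ℓ i : ℝ) * P i - ℓ i * ∑ j, lam j * C i j)|
        ≤ ∑ i, |(ℓ i : ℝ) * P i - ℓ i * ∑ j, lam j * C i j| := Finset.abs_sum_le_sum_abs _ _
      _ ≤ ∑ _i : ι, Real.exp ((1 + δ) * x) * Real.exp (-(1 + ε) * s) := by
          refine Finset.sum_le_sum fun i _ => ?_
          rw [← mul_sub, abs_mul]
          exact mul_le_mul (hℓ i) (hclose i).le (abs_nonneg _) (Real.exp_pos _).le
      _ ≤ ∑ _i : ι, Real.exp (-δ * s) * (Real.exp (-(2 * η * T) * s) * Real.exp (-δ * x)) := by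
          refine Finset.sum_le_sum fun i _ => ?_
          rw [← Real.exp_add, ← Real.exp_add, ← Real.exp_add, Real.exp_le_exp]
          nlinarith
      _ = Fintype.card ι * Real.exp (-δ * s) *
            (Real.exp (-(2 * η * T) * s) * Real.exp (-δ * x)) := by
          rw [Finset.sum_const, Finset.card_univ, nsmul_eq_mul]
          ring
      _ ≤ 1 / 4 * (E * Real.exp (-δ * x)) := by gcongr
  have hcast : (∑ i, (ℓ i : ℝ) * P i) = ((∑ i, ℓ i * P i : ℤ) : ℝ) := by push_cast; rfl
  have hEx : 0 < E * Real.exp (-δ * x) := by positivity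
  have hA := abs_sub_abs_le_abs_sub (∑ j, v j) (∑ i, (ℓ i : ℝ) * P i)
  have hB := abs_sub_abs_le_abs_sub (∑ i, (ℓ i : ℝ) * P i) (∑ j, v j)
  rw [abs_sub_comm] at hA
  have h1 : 0 < |∑ i, (ℓ i : ℝ) * P i| := by linarith
  have h2 : |∑ i, (ℓ i : ℝ) * P i| < 1 := by linarith
  rw [hcast, ← Int.cast_abs] at h1 h2
  have h3 : 0 < |∑ i, ℓ i * P i| := by exact_mod_cast h1
  have h4 : |∑ i, ℓ i * P i| < 1 := by exact_mod_cast h2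
  omega

/-- For bounded `lam` the points `∑ j, lam j • (C i j)_i` form a compact set that contains no
non-zero integer point, hence has a positive distance to the non-zero integer points. -/
theorem HasSmallForms.exists_pos_le_of_le {ι κ : Type*} [Fintype ι] [Fintype κ] {C : ι → κ → ℝ}
    {τ : κ → ℝ} (H : HasSmallForms C τ) (hpos : ∀ j, 0 < τ j) (hinj : Function.Injective τ)
    (R : κ → ℝ) :
    ∃ d > 0, ∀ lam : κ → ℝ, (∀ j, |lam j| ≤ R j) → ∀ P : ι → ℤ, P ≠ 0 →
      ∃ i, d ≤ |P i - ∑ j, lam j * C i j| := by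
  set f : (κ → ℝ) → ι → ℝ := fun lam i => ∑ j, lam j * C i j with hf
  have hfc : Continuous f := by fun_prop
  have hK : IsCompact (f '' Set.univ.pi fun j => Set.Icc (-R j) (R j)) :=
    (isCompact_univ_pi fun j => isCompact_Icc).image hfc
  set Z : Set (ι → ℝ) := (fun (P : ι → ℤ) i => (P i : ℝ)) '' {P | P ≠ 0} with hZ
  have hZc : IsClosed Z := by
    refine Metric.isClosed_of_pairwise_le_dist one_pos ?_
    rintro _ ⟨P, -, rfl⟩ _ ⟨P', -, rfl⟩ hne
    obtain ⟨i, hi⟩ := Function.ne_iff.1 hne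
    refine le_trans ?_ (dist_le_pi_dist _ _ i)
    simp only [ne_eq, Int.cast_inj] at hi
    rw [Int.dist_cast_real, Int.dist_eq]
    exact_mod_cast Int.one_le_abs (sub_ne_zero.2 hi)
  have hdisj : Disjoint (f '' Set.univ.pi fun j => Set.Icc (-R j) (R j)) Z := by
    rw [Set.disjoint_left]
    rintro _ ⟨lam, -, rfl⟩ ⟨P, hP, hPe⟩
    have hlam : lam ≠ 0 := by
      rintro rfl
      refine hP (funext fun i => ?_)
      have := congrFun hPe i
      simpa [hf] using this
    obtain ⟨i, hi⟩ := H.exists_ne_intCast hpos hinj hlam P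
    exact hi (congrFun hPe i).symm
  obtain ⟨d, hd, hdd⟩ := hdisj.exists_thickenings hK hZc
  refine ⟨d, hd, fun lam hlam P hP => ?_⟩
  by_contra! hc
  have h1 : f lam ∈ f '' Set.univ.pi fun j => Set.Icc (-R j) (R j) :=
    ⟨lam, fun j _ => abs_le.1 (hlam j), rfl⟩
  refine Set.disjoint_left.1 hdd (Metric.self_subset_thickening hd _ h1) ?_
  refine Metric.mem_thickening_iff.2 ⟨_, ⟨P, hP, rfl⟩, ?_⟩
  rw [dist_comm, dist_pi_lt_iff hd]
  intro i
  rw [Real.dist_eq]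
  exact hc i

/-- The distance estimate, in the sup norm and on the logarithmic scale `s = log T`. It follows
from `HasSmallForms.eventually_le_of_eq` at the least `s' ≤ s` such that
`|lam j| ≤ exp (τ j * s')` for all `j`, or from compactness if `s'` is bounded. -/
theorem HasSmallForms.eventually_le {ι κ : Type*} [Fintype ι] [Fintype κ] {C : ι → κ → ℝ}
    {τ : κ → ℝ} (H : HasSmallForms C τ) (hpos : ∀ j, 0 < τ j) (hinj : Function.Injective τ)
    {ε : ℝ} (hε : 0 < ε) :
    ∀ᶠ s : ℝ in atTop, ∀ lam : κ → ℝ, (∀ j, |lam j| ≤ Real.exp (τ j * s)) →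
      ∀ P : ι → ℤ, P ≠ 0 → ∃ i, Real.exp (-(1 + ε) * s) ≤ |P i - ∑ j, lam j * C i j| := by
  obtain ⟨s₀, hs₀⟩ := eventually_atTop.1 (H.eventually_le_of_eq hpos hinj hε)
  obtain ⟨d, hd, hdist⟩ := H.exists_pos_le_of_le hpos hinj fun j => Real.exp (τ j * s₀)
  filter_upwards [eventually_mul_exp_neg_le 1 (by positivity : 0 < 1 + ε) hd] with
    s hs lam hlam P hP
  rw [one_mul] at hs
  by_cases hsmall : ∀ j, |lam j| ≤ Real.exp (τ j * s₀)
  · obtain ⟨i, hi⟩ := hdist lam hsmall P hP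
    exact ⟨i, hs.trans hi⟩
  push Not at hsmall
  obtain ⟨j₁, hj₁⟩ := hsmall
  classical
  obtain ⟨j₀, hj₀, hmax⟩ := Finset.exists_max_image (Finset.univ.filter fun j => lam j ≠ 0)
    (fun j => Real.log |lam j| / τ j)
    ⟨j₁, by simpa using abs_pos.1 ((Real.exp_pos _).trans hj₁)⟩
  set s' := Real.log |lam j₀| / τ j₀ with hs'
  have hle : ∀ j, |lam j| ≤ Real.exp (τ j * s') := by
    intro j
    by_cases hj : lam j = 0
    · rw [hj, abs_zero]
      positivity
    have h1 := hmax j (by simpa using hj)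
    rw [div_le_iff₀ (hpos j), mul_comm] at h1
    exact (Real.log_le_iff_le_exp (abs_pos.2 hj)).1 h1
  have heq : |lam j₀| = Real.exp (τ j₀ * s') := by
    rw [hs', mul_div_cancel₀ _ (hpos j₀).ne', Real.exp_log]
    exact abs_pos.2 (by simpa using hj₀)
  have hs₀s' : s₀ ≤ s' := by
    have := Real.exp_lt_exp.1 (hj₁.trans_le (hle j₁))
    exact (lt_of_mul_lt_mul_left this (hpos j₁).le).le
  have hs's : s' ≤ s := by
    have := hlam j₀
    rw [heq, Real.exp_le_exp] at this
    exact le_of_mul_le_mul_left this (hpos j₀)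
  obtain ⟨i, hi⟩ := hs₀ s' hs₀s' lam hle ⟨j₀, heq⟩ P
  refine ⟨i, le_trans (Real.exp_le_exp.2 ?_) hi⟩
  nlinarith

/-! ### Oscillating linear forms -/

/-- Recurrence: the points `f t = (exp (i t ω j))_j` lie in a compact set, so finitely many of the
balls of radius `c / 2` around points `f (g y)` cover them all. Hence every `t` lies within
bounded distance of a return time `t - g y`, that is, one that moves the phases by little; add it
to `n₀`. -/
lemma exists_bounded_gaps_abs_cos_ge {κ : Type*} [Fintype κ] (ω φ : κ → ℝ) (n₀ : ℤ)
    (h₀ : ∀ j, Real.cos (n₀ * ω j + φ j) ≠ 0) :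
    ∃ c > 0, ∃ M : ℕ, ∀ N : ℕ, ∃ n, N ≤ n ∧ n ≤ N + M ∧
      ∀ j, c ≤ |Real.cos (n * ω j + φ j)| := by
  obtain ⟨c, hc, hc'⟩ := exists_pos_forall_le _ fun j => abs_pos.2 (h₀ j)
  set f : ℤ → κ → ℂ := fun t j => Complex.exp (((t * ω j : ℝ) : ℂ) * Complex.I) with hf
  have hbdd : TotallyBounded (Set.range f) := by
    refine (isCompact_closedBall (0 : κ → ℂ) 1).totallyBounded.subset ?_
    rintro _ ⟨t, rfl⟩
    rw [mem_closedBall_zero_iff, pi_norm_le_iff_of_nonneg zero_le_one]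
    exact fun j => (Complex.norm_exp_ofReal_mul_I _).le
  obtain ⟨S, hSf, hS, hcov⟩ := Metric.finite_approx_of_totallyBounded hbdd (c / 2) (by positivity)
  have hSf' : ∀ y ∈ S, ∃ t, f t = y := fun y hy => hSf hy
  choose! g hg using hSf'
  obtain ⟨B, hB⟩ := (hS.image fun y => |g y|).bddAbove
  refine ⟨c / 2, by positivity, (2 * B).toNat, fun N => ?_⟩
  obtain ⟨y, hy, hty⟩ := Set.mem_iUnion₂.1 (hcov ⟨N - n₀ + B, rfl⟩)
  have hgB := abs_le.1 (hB ⟨y, hy, rfl⟩)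
  refine ⟨(N + B - g y).toNat, by omega, by omega, fun j => ?_⟩
  have hn : (((N + B - g y).toNat : ℕ) : ℝ) = N + B - g y := by
    have : (((N + B - g y).toNat : ℕ) : ℤ) = N + B - g y := Int.toNat_of_nonneg (by omega)
    exact_mod_cast this
  have hdist : ‖f (N - n₀ + B) j - f (g y) j‖ ≤ c / 2 := by
    rw [hg y hy, ← dist_eq_norm]
    exact (dist_le_pi_dist _ _ j).trans (Metric.mem_ball.1 hty).le
  have hcos : Real.cos ((N + B - g y : ℝ) * ω j + φ j) - Real.cos (n₀ * ω j + φ j) =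
      (Complex.exp (((n₀ * ω j + φ j - g y * ω j : ℝ) : ℂ) * Complex.I) *
        (f (N - n₀ + B) j - f (g y) j)).re := by
    rw [hf, mul_sub, ← Complex.exp_add, ← Complex.exp_add, ← add_mul, ← add_mul,
      ← Complex.ofReal_add, ← Complex.ofReal_add, Complex.sub_re,
      Complex.exp_ofReal_mul_I_re, Complex.exp_ofReal_mul_I_re]
    push_cast
    ring_nf
  have hclose : |Real.cos ((N + B - g y : ℝ) * ω j + φ j) - Real.cos (n₀ * ω j + φ j)| ≤ c / 2 := by
    rw [hcos]
    refine (Complex.abs_re_le_norm _).trans ?_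
    rw [norm_mul, Complex.norm_exp_ofReal_mul_I, one_mul]
    exact hdist
  rw [hn]
  have h1 := abs_sub_abs_le_abs_sub (Real.cos (n₀ * ω j + φ j))
    (Real.cos ((N + B - g y : ℝ) * ω j + φ j))
  rw [abs_sub_comm] at h1
  linarith [hc' j]

lemma eventually_add_le_mul {q : ℕ → ℝ} (hq : Tendsto q atTop atTop)
    (h : ∀ ε > 0, ∀ᶠ n in atTop, q (n + 1) ≤ (1 + ε) * q n) (M : ℕ) :
    ∀ ε > 0, ∀ᶠ n in atTop, q (n + M) ≤ (1 + ε) * q n := by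
  induction M with
  | zero =>
    intro ε hε
    filter_upwards [hq.eventually_ge_atTop 0] with n hn
    rw [add_zero]
    nlinarith
  | succ M ih =>
    intro ε hε
    set δ := min 1 (ε / 3) with hδ
    have hδ0 : 0 < δ := by positivity
    have h1 : δ ≤ 1 := min_le_left _ _
    have h2 : δ ≤ ε / 3 := min_le_right _ _
    filter_upwards [ih δ hδ0, (tendsto_add_atTop_nat M).eventually (h δ hδ0),
      hq.eventually_ge_atTop 0] with n hn1 hn2 hn3
    calc q (n + (M + 1)) ≤ (1 + δ) * q (n + M) := hn2
      _ ≤ (1 + δ) * ((1 + δ) * q n) := by gcongr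
      _ ≤ (1 + ε) * q n := by
        rw [← mul_assoc]
        gcongr
        nlinarith

/-- If the indices satisfying `G` have bounded gaps, then the values of `q` at these indices meet
`[x, (1 + ε) * x]` for all large `x`. -/
lemma eventually_exists_mem_Icc {q : ℕ → ℝ} (hq : Tendsto q atTop atTop)
    (hmono : MonotoneOn q (Set.Ici 1))
    (h : ∀ ε > 0, ∀ᶠ n in atTop, q (n + 1) ≤ (1 + ε) * q n) {G : ℕ → Prop} {M : ℕ}
    (hG : ∀ N, ∃ n, N ≤ n ∧ n ≤ N + M ∧ G n) (N₀ : ℕ) {ε : ℝ} (hε : 0 < ε) :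
    ∀ᶠ x : ℝ in atTop, ∃ n ≥ N₀, G n ∧ q n ∈ Set.Icc x ((1 + ε) * x) := by
  obtain ⟨N₁, hN₁⟩ := eventually_atTop.1 (eventually_add_le_mul hq h (M + 1) ε hε)
  set N := max N₁ (max N₀ 1) with hN
  filter_upwards [eventually_gt_atTop (q N)] with x hx
  classical
  have hex : ∃ m, N ≤ m ∧ x ≤ q m :=
    ((eventually_ge_atTop N).and (hq.eventually_ge_atTop x)).exists
  set m := Nat.find hex with hm
  obtain ⟨hNm, hxm⟩ := Nat.find_spec hex
  rw [← hm] at hNm hxm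
  have hNm' : N < m := lt_of_le_of_ne hNm (by rintro heq; rw [← heq] at hxm; linarith)
  have hlt : q (m - 1) < x := by
    have := Nat.find_min hex (m := m - 1) (by omega)
    push Not at this
    exact this (by omega)
  obtain ⟨n, hmn, hnm, hGn⟩ := hG m
  have h1 : N₁ ≤ N := le_max_left _ _
  have h2 : N₀ ≤ N := (le_max_left _ _).trans (le_max_right _ _)
  have h3 : 1 ≤ N := (le_max_right _ _).trans (le_max_right _ _)
  refine ⟨n, by omega, hGn, hxm.trans (hmono ?_ ?_ hmn), ?_⟩
  · exact h3.trans hNm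
  · exact (h3.trans hNm).trans hmn
  calc q n ≤ q (m - 1 + (M + 1)) :=
        hmono ((h3.trans hNm).trans hmn) (by simp only [Set.mem_Ici]; omega) (by omega)
    _ ≤ (1 + ε) * q (m - 1) := hN₁ _ (by omega)
    _ ≤ (1 + ε) * x := by gcongr

set_option maxHeartbeats 1000000 in
/-- Along the indices where all cosines are at least `c` in absolute value, the factors
`cos (n * ω j + φ j) + o(1)` lie between `exp (-δ * log (Q n))` and `exp (δ * log (Q n))`. -/
theorem hasSmallForms_of_oscillating {ι κ : Type*} [Fintype ι] [Fintype κ] {C : ι → κ → ℝ}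
    {τ ω φ : κ → ℝ} (hpos : ∀ j, 0 < τ j)
    {n₀ : ℤ} (h₀ : ∀ j, Real.cos (n₀ * ω j + φ j) ≠ 0)
    {Q : ℕ → ℕ} (hQ_pos : ∀ n, 1 ≤ n → 0 < Q n) (hQ_mono : StrictMonoOn Q (Set.Ici 1))
    (hQ_growth : ∃ u : ℕ → ℝ, Tendsto u atTop (𝓝 0) ∧
      ∀ᶠ n in atTop, (Q (n + 1) : ℝ) = (Q n : ℝ) ^ (1 + u n))
    {ℓ : ι → ℕ → ℤ}
    (hℓ_bound : ∃ u : ℕ → ℝ, Tendsto u atTop (𝓝 0) ∧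
      ∀ᶠ n in atTop, ∀ i, |(ℓ i n : ℝ)| ≤ (Q n : ℝ) ^ (1 + u n))
    (hℓ_small : ∀ j, ∃ a b : ℕ → ℝ, Tendsto a atTop (𝓝 0) ∧ Tendsto b atTop (𝓝 0) ∧
      ∀ᶠ n in atTop, |∑ i, (ℓ i n : ℝ) * C i j| =
        (Q n : ℝ) ^ (-τ j + a n) * |Real.cos (n * ω j + φ j) + b n|) :
    HasSmallForms C τ := by
  intro ε hε
  obtain ⟨c, hc, M, hM⟩ := exists_bounded_gaps_abs_cos_ge ω φ n₀ h₀
  set q : ℕ → ℝ := fun n => Real.log (Q n) with hqdef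
  have hrpow : ∀ n, 1 ≤ n → ∀ y : ℝ, (Q n : ℝ) ^ y = Real.exp (y * q n) := by
    intro n hn y
    rw [Real.rpow_def_of_pos (by exact_mod_cast hQ_pos n hn), mul_comm]
  have hQle : ∀ n, n ≤ Q (n + 1) := by
    intro n
    induction n with
    | zero => exact Nat.zero_le _
    | succ n ih =>
      have : Q (n + 1) < Q (n + 1 + 1) :=
        hQ_mono (by simp only [Set.mem_Ici]; omega) (by simp only [Set.mem_Ici]; omega)
          (by omega)
      omega
  have hq : Tendsto q atTop atTop := by
    refine Real.tendsto_log_atTop.comp (tendsto_natCast_atTop_atTop.comp ?_)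
    rw [← tendsto_add_atTop_iff_nat 1]
    exact tendsto_atTop_mono hQle tendsto_id
  have hmono : MonotoneOn q (Set.Ici 1) := by
    intro m hm n hn hmn
    exact Real.log_le_log (by exact_mod_cast hQ_pos m hm)
      (by exact_mod_cast hQ_mono.monotoneOn hm hn hmn)
  have hgrowth : ∀ δ > 0, ∀ᶠ n in atTop, q (n + 1) ≤ (1 + δ) * q n := by
    obtain ⟨u, hu, huQ⟩ := hQ_growth
    intro δ hδ
    filter_upwards [huQ, hu.eventually (gt_mem_nhds hδ), eventually_ge_atTop 1,
      hq.eventually_ge_atTop 0] with n h1 h2 h3 h4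
    have : q (n + 1) = (1 + u n) * q n := by
      rw [hqdef]
      simp only
      rw [h1, Real.log_rpow (by exact_mod_cast hQ_pos n h3)]
    rw [this]
    gcongr
  obtain ⟨T, hT0, hT⟩ : ∃ T : ℝ, 0 ≤ T ∧ ∀ j, τ j ≤ T :=
    ⟨∑ j, τ j, Finset.sum_nonneg fun j _ => (hpos j).le, fun j =>
      Finset.single_le_sum (fun j _ => (hpos j).le) (Finset.mem_univ j)⟩
  set δ := min 1 (ε / (T + 4)) with hδ
  have hδ0 : 0 < δ := by positivity
  have hδ1 : δ ≤ 1 := min_le_left _ _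
  have hδ2 : δ * (T + 4) ≤ ε := by
    have : δ ≤ ε / (T + 4) := min_le_right _ _
    rwa [le_div_iff₀ (by positivity)] at this
  obtain ⟨u, hu, huℓ⟩ := hℓ_bound
  choose a b ha hb hab using hℓ_small
  have hev : ∀ᶠ n in atTop, 1 ≤ n ∧ 0 ≤ q n ∧ 2 * Real.exp (-δ * q n) ≤ min c 1 ∧
      (∀ i, |(ℓ i n : ℝ)| ≤ (Q n : ℝ) ^ (1 + u n)) ∧ u n < δ ∧
      (∀ j, |a j n| < δ) ∧ (∀ j, |b j n| < min (c / 2) 1) ∧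
      ∀ j, |∑ i, (ℓ i n : ℝ) * C i j| =
        (Q n : ℝ) ^ (-τ j + a j n) * |Real.cos (n * ω j + φ j) + b j n| := by
    have hsm : ∀ {w : ℕ → ℝ}, Tendsto w atTop (𝓝 0) → ∀ d > 0, ∀ᶠ n in atTop, |w n| < d :=
      fun hw d hd => by
        have := hw.abs
        rw [abs_zero] at this
        exact this.eventually (gt_mem_nhds hd)
    exact (eventually_ge_atTop 1).and ((hq.eventually_ge_atTop 0).and
      ((hq.eventually (eventually_mul_exp_neg_le 2 hδ0 (by positivity))).and
      (huℓ.and ((hu.eventually (gt_mem_nhds hδ0)).and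
      ((eventually_all.2 fun j => hsm (ha j) δ hδ0).and
      ((eventually_all.2 fun j => hsm (hb j) _ (by positivity)).and
      (eventually_all.2 hab)))))))
  obtain ⟨N₀, hN₀⟩ := eventually_atTop.1 hev
  filter_upwards [eventually_exists_mem_Icc hq hmono hgrowth hM N₀ hδ0,
    eventually_ge_atTop 0] with x ⟨n, hn, hcn, hxq, hqx⟩ hx0
  obtain ⟨h1, hq0, hqc, hℓn, hun, han, hbn, habn⟩ := hN₀ n hn
  have hexp1 : 2 * Real.exp (-δ * q n) ≤ c := hqc.trans (min_le_left _ _)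
  have hexp2 : 2 ≤ Real.exp (δ * q n) := by
    have := hqc.trans (min_le_right _ _)
    rw [neg_mul, Real.exp_neg, ← div_eq_mul_inv, div_le_one (Real.exp_pos _)] at this
    exact this
  have hqxx : q n - x ≤ δ * x := by linarith
  have hδx : δ * q n ≤ 2 * δ * x := by nlinarith
  have hεx : δ * (T + 4) * x ≤ ε * x := mul_le_mul_of_nonneg_right hδ2 hx0
  have hTx : 0 ≤ T * (δ * x) := by positivity
  have hdx : 0 ≤ δ * x := by positivity
  refine ⟨fun i => ℓ i n, fun i => (hℓn i).trans ?_, fun j => ?_⟩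
  · rw [hrpow n h1, Real.exp_le_exp]
    have : u n * q n ≤ δ * q n := mul_le_mul_of_nonneg_right hun.le hq0
    linarith
  have haq : |a j n * q n| ≤ δ * q n := by
    rw [abs_mul, abs_of_nonneg hq0]
    exact mul_le_mul_of_nonneg_right (han j).le hq0
  have haq' := abs_le.1 haq
  have hτq : τ j * x ≤ τ j * q n := mul_le_mul_of_nonneg_left hxq (hpos j).le
  have hτq' : τ j * (q n - x) ≤ T * (δ * x) :=
    mul_le_mul (hT j) hqxx (by linarith) hT0
  rw [habn j, hrpow n h1]
  constructor
  · have hcos : Real.exp (-δ * q n) ≤ |Real.cos (n * ω j + φ j) + b j n| := by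
      have h2 := abs_sub_abs_le_abs_sub (Real.cos (n * ω j + φ j)) (-b j n)
      rw [abs_neg, sub_neg_eq_add] at h2
      have h3 := (hbn j).trans_le (min_le_left _ _)
      linarith [hcn j]
    refine le_trans ?_ (mul_le_mul_of_nonneg_left hcos (Real.exp_pos _).le)
    rw [← Real.exp_add, Real.exp_le_exp]
    linarith
  · have hcos : |Real.cos (n * ω j + φ j) + b j n| ≤ Real.exp (δ * q n) := by
      have h2 := abs_add_le (Real.cos (n * ω j + φ j)) (b j n)
      have h3 := (hbn j).trans_le (min_le_right _ _)
      linarith [Real.abs_cos_le_one (n * ω j + φ j)]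
    refine le_trans (mul_le_mul_of_nonneg_left hcos (Real.exp_pos _).le) ?_
    rw [← Real.exp_add, Real.exp_le_exp]
    linarith

/-! ### The rank -/

lemma LinearIndependent.exists_basis_sum {ι K V : Type*} [DivisionRing K] [AddCommGroup V]
    [Module K V] [FiniteDimensional K V] {v : ι → V} (hv : LinearIndependent K v) :
    ∃ (E : Set V) (_ : Fintype E) (b : Module.Basis (ι ⊕ E) K V), ∀ i, b (Sum.inl i) = v i := by
  have := Module.Finite.finite_basis (Module.Basis.sumExtend hv)
  have : Finite (Module.Basis.sumExtendIndex hv) :=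
    Finite.of_injective (Sum.inr : _ → ι ⊕ _) Sum.inr_injective
  refine ⟨_, Fintype.ofFinite _, Module.Basis.sumExtend hv, fun i => ?_⟩
  simp only [Module.Basis.sumExtend, Module.Basis.reindex_apply, Module.Basis.extend_apply_self]
  rfl

open Module in
/-- A finite family in a rational vector space is an integral combination of as many vectors as
its rank over `ℚ`: take a `ℤ`-basis of the subgroup that it generates. -/
lemma exists_fin_finrank_int_combinations {V ι : Type*} [AddCommGroup V] [Module ℚ V]
    [Finite ι] (C : ι → V) :
    ∃ (D : Fin (finrank ℚ (Submodule.span ℚ (Set.range C))) → V)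
      (A : ι → Fin (finrank ℚ (Submodule.span ℚ (Set.range C))) → ℤ),
      ∀ i, C i = ∑ s, A i s • D s := by
  have : IsAddTorsionFree V := .of_module_rat V
  set L := Submodule.span ℤ (Set.range C) with hL
  have : Module.Finite ℤ L := Module.Finite.span_of_finite ℤ (Set.finite_range C)
  let b := Module.finBasis ℤ L
  have hli : LinearIndependent ℚ fun s => (b s : V) := by
    rw [← LinearIndependent.iff_fractionRing ℤ ℚ]
    exact b.linearIndependent.map' L.subtype L.ker_subtype
  have hspan : Submodule.span ℚ (Set.range fun s => (b s : V)) =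
      Submodule.span ℚ (Set.range C) := by
    have h : Submodule.span ℤ (Set.range fun s => (b s : V)) = Submodule.span ℤ (Set.range C) := by
      have : (Set.range fun s => (b s : V)) = L.subtype '' Set.range b := by
        rw [← Set.range_comp]; rfl
      rw [this, ← Submodule.map_span, b.span_eq, Submodule.map_top, Submodule.range_subtype]
    rw [← Submodule.span_span_of_tower ℤ ℚ (Set.range C), ← h, Submodule.span_span_of_tower]
  have hrank : finrank ℚ (Submodule.span ℚ (Set.range C)) = finrank ℤ L := by
    rw [← hspan, finrank_span_eq_card hli, Fintype.card_fin]
  rw [hrank]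
  refine ⟨fun s => (b s : V), fun i => b.repr ⟨C i, Submodule.subset_span ⟨i, rfl⟩⟩, fun i => ?_⟩
  have := congrArg Subtype.val (b.sum_repr ⟨C i, Submodule.subset_span ⟨i, rfl⟩⟩)
  rw [Submodule.coe_sum] at this
  exact this.symm

/-- Substituting `C i = ∑ s, A i s • D s` turns an integer form in the `C i` into one in the `D s`
with the same values and with coefficients larger by at most a constant factor. -/
lemma HasSmallForms.of_int_combinations {ι ι' κ : Type*} [Fintype ι] [Fintype ι'] [Fintype κ]
    {C : ι → κ → ℝ} {D : ι' → κ → ℝ} {τ : κ → ℝ} (H : HasSmallForms C τ) (A : ι → ι' → ℤ)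
    (hA : ∀ i, C i = ∑ s, A i s • D s) : HasSmallForms D τ := by
  intro ε hε
  filter_upwards [H (ε / 2) (by positivity), eventually_ge_atTop 0,
    eventually_mul_exp_neg_le (∑ i, ∑ s, |(A i s : ℝ)|) (half_pos hε) one_pos]
    with x ⟨ℓ, hℓ, hℓC⟩ hx0 hx
  have hform : ∀ j, ∑ s, ((∑ i, ℓ i * A i s : ℤ) : ℝ) * D s j = ∑ i, (ℓ i : ℝ) * C i j := by
    intro j
    simp only [hA, Finset.sum_apply, zsmul_eq_mul, Finset.mul_sum, Int.cast_sum,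
      Int.cast_mul, Finset.sum_mul, mul_assoc]
    rw [Finset.sum_comm]
    rfl
  refine ⟨fun s => ∑ i, ℓ i * A i s, fun s => ?_, fun j => ?_⟩
  · calc |((∑ i, ℓ i * A i s : ℤ) : ℝ)| ≤ ∑ i, |(ℓ i : ℝ) * A i s| := by
          push_cast
          exact Finset.abs_sum_le_sum_abs _ _
      _ ≤ ∑ i, ∑ s, |(A i s : ℝ)| * Real.exp ((1 + ε / 2) * x) := by
          refine Finset.sum_le_sum fun i _ => ?_
          rw [abs_mul, mul_comm]
          refine (mul_le_mul_of_nonneg_left (hℓ i) (abs_nonneg _)).trans ?_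
          exact Finset.single_le_sum
            (f := fun s => |(A i s : ℝ)| * Real.exp ((1 + ε / 2) * x))
            (fun s _ => by positivity) (Finset.mem_univ s)
      _ = (∑ i, ∑ s, |(A i s : ℝ)|) * Real.exp (-(ε / 2) * x) * Real.exp ((1 + ε) * x) := by
          rw [mul_assoc, ← Real.exp_add, Finset.sum_mul]
          refine Finset.sum_congr rfl fun i _ => ?_
          rw [Finset.sum_mul]
          refine Finset.sum_congr rfl fun s _ => ?_
          congr 2
          ring
      _ ≤ 1 * Real.exp ((1 + ε) * x) := by gcongr
      _ = Real.exp ((1 + ε) * x) := one_mul _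
  · rw [hform]
    refine ⟨le_trans (Real.exp_le_exp.2 ?_) (hℓC j).1,
      (hℓC j).2.trans (Real.exp_le_exp.2 ?_)⟩ <;> nlinarith

open MeasureTheory in
/-- Minkowski's theorem on linear forms: a box in the coordinates of `b` contains a non-zero
integer point as soon as the product of its half side lengths exceeds a constant depending on
`b`. -/
lemma Module.Basis.exists_int_ne_zero_forall_abs_repr_le {ι ι' : Type*} [Fintype ι] [Fintype ι']
    (b : Module.Basis ι' ℝ (ι → ℝ)) :
    ∃ V : ℝ, ∀ R : ι' → ℝ, (∀ i, 0 ≤ R i) → V < ∏ i, R i →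
      ∃ P : ι → ℤ, P ≠ 0 ∧ ∀ i, |b.repr (fun k => (P k : ℝ)) i| ≤ R i := by
  classical
  set b₀ := (Pi.basisFun ℝ ι).map b.equivFun with hb₀
  set F := ZSpan.fundamentalDomain b₀ with hF
  have hFfin : volume F ≠ ⊤ := (ZSpan.fundamentalDomain_isBounded b₀).measure_lt_top.ne
  refine ⟨(volume F).toReal * 2 ^ Module.finrank ℝ (ι' → ℝ), fun R hR hV => ?_⟩
  have : Countable (Submodule.span ℤ (Set.range b₀)).toAddSubgroup := by
    change Countable (Submodule.span ℤ (Set.range b₀))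
    infer_instance
  have hvol : volume F * 2 ^ Module.finrank ℝ (ι' → ℝ) < volume (Set.Icc (-R) R) := by
    rw [Real.volume_Icc_pi, ← ENNReal.ofReal_prod_of_nonneg
      (fun i _ => by simp only [Pi.neg_apply]; linarith [hR i]), ← ENNReal.ofReal_toReal hFfin,
      ← ENNReal.ofReal_ofNat, ← ENNReal.ofReal_pow (by norm_num),
      ← ENNReal.ofReal_mul ENNReal.toReal_nonneg]
    refine (ENNReal.ofReal_lt_ofReal_iff_of_nonneg (by positivity)).2 (hV.trans_le ?_)
    refine Finset.prod_le_prod (fun i _ => hR i) fun i _ => ?_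
    simp only [Pi.neg_apply]
    linarith [hR i]
  have hsymm : ∀ y ∈ Set.Icc (-R) R, -y ∈ Set.Icc (-R) R := fun y hy =>
    ⟨neg_le_neg hy.2, neg_le.1 hy.1⟩
  obtain ⟨⟨x, hx⟩, hx0, hxR⟩ := exists_ne_zero_mem_lattice_of_measure_mul_two_pow_lt_measure
    (ZSpan.isAddFundamentalDomain' b₀ volume) hsymm
    (convex_Icc _ _) hvol
  rw [Submodule.mem_toAddSubgroup, Submodule.mem_span_range_iff_exists_fun] at hx
  obtain ⟨P, rfl⟩ := hx
  have hP : ∑ i, P i • b₀ i = b.equivFun fun k => (P k : ℝ) := by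
    have : (fun k => (P k : ℝ)) = ∑ i, P i • Pi.basisFun ℝ ι i := by
      ext k
      simp [Finset.sum_apply, Pi.single_apply]
    rw [this, map_sum]
    simp only [map_zsmul]
    rfl
  refine ⟨P, ?_, fun i => ?_⟩
  · rintro rfl
    exact hx0 (by simp)
  · simp only [hP] at hxR
    exact abs_le.2 ⟨hxR.1 i, hxR.2 i⟩

/-- The box with half side lengths `exp (τ j * s)` along the points `(C i j)_i` and a small
multiple of `exp (-(1 + ε) * s)` along the complementary directions contains no non-zero integer
point for large `s`, so its volume is bounded, which gives
`∑ j, τ j ≤ (1 + ε) * (card ι - card κ)`. -/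
theorem HasSmallForms.card_add_sum_le {ι κ : Type*} [Fintype ι] [Fintype κ] {C : ι → κ → ℝ}
    {τ : κ → ℝ} (H : HasSmallForms C τ) (hpos : ∀ j, 0 < τ j) (hinj : Function.Injective τ) :
    Fintype.card κ + ∑ j, τ j ≤ Fintype.card ι := by
  have hli : LinearIndependent ℝ fun j i => C i j := by
    rw [Fintype.linearIndependent_iff]
    intro lam hlam
    by_contra! hne
    obtain ⟨i, hi⟩ := H.exists_ne_intCast hpos hinj (lam := lam)
      (fun h => by obtain ⟨j, hj⟩ := hne; exact hj (congrFun h j)) 0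
    have := congrFun hlam i
    simp only [Finset.sum_apply, Pi.smul_apply, smul_eq_mul, Pi.zero_apply] at this
    exact hi (by simpa using this)
  obtain ⟨E, _, b, hb⟩ := hli.exists_basis_sum
  have hcard : Fintype.card κ + Fintype.card E = Fintype.card ι := by
    rw [← Fintype.card_sum, ← Module.finrank_eq_card_basis b, Module.finrank_fintype_fun_eq_card]
  obtain ⟨V, hV⟩ := b.exists_int_ne_zero_forall_abs_repr_le
  -- A combination of the complementary vectors with coefficients at most `S⁻¹` has sup norm
  -- below `1`.
  set S := 1 + ∑ i, ∑ e, |b (Sum.inr e) i| with hS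
  have hS0 : 0 < S := by positivity
  have key : ∀ ε > 0, ∑ j, τ j ≤ (1 + ε) * Fintype.card E := by
    intro ε hε
    by_contra! hlt
    have hgrow : Tendsto (fun s : ℝ => (S⁻¹ ^ Fintype.card E) *
        Real.exp ((∑ j, τ j - (1 + ε) * Fintype.card E) * s)) atTop atTop :=
      (Real.tendsto_exp_atTop.comp (tendsto_id.const_mul_atTop (by linarith))).const_mul_atTop
        (by positivity)
    obtain ⟨s, hs, hsV⟩ := ((H.eventually_le hpos hinj hε).and
      (hgrow.eventually_gt_atTop V)).exists
    obtain ⟨P, hP, hPR⟩ := hV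
      (Sum.elim (fun j => Real.exp (τ j * s)) fun _ => Real.exp (-(1 + ε) * s) * S⁻¹)
      (by rintro (j | e) <;> simp only [Sum.elim_inl, Sum.elim_inr] <;> positivity)
      (by
        refine hsV.trans_eq ?_
        rw [Fintype.prod_sum_type]
        simp only [Sum.elim_inl, Sum.elim_inr, Finset.prod_const, Finset.card_univ]
        rw [← Real.exp_sum, mul_pow, ← Real.exp_nat_mul, ← mul_assoc, ← Real.exp_add, mul_comm,
          ← Finset.sum_mul]
        ring_nf)
    set r := b.repr fun k => (P k : ℝ) with hr
    obtain ⟨i, hi⟩ := hs (fun j => r (Sum.inl j)) (fun j => hPR (Sum.inl j)) P hP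
    have hdecomp : (P i : ℝ) - ∑ j, r (Sum.inl j) * C i j =
        ∑ e, r (Sum.inr e) * b (Sum.inr e) i := by
      have h1 := congrFun (b.sum_repr fun k => (P k : ℝ)) i
      rw [Fintype.sum_sum_type] at h1
      simp only [Pi.add_apply, Finset.sum_apply, Pi.smul_apply, smul_eq_mul, hb] at h1
      rw [← h1]
      exact add_sub_cancel_left _ _
    rw [hdecomp] at hi
    have hlt' : |∑ e, r (Sum.inr e) * b (Sum.inr e) i| < Real.exp (-(1 + ε) * s) := by
      calc |∑ e, r (Sum.inr e) * b (Sum.inr e) i|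
          ≤ ∑ e, |r (Sum.inr e) * b (Sum.inr e) i| := Finset.abs_sum_le_sum_abs _ _
        _ ≤ ∑ e, Real.exp (-(1 + ε) * s) * S⁻¹ * |b (Sum.inr e) i| := by
            refine Finset.sum_le_sum fun e _ => ?_
            rw [abs_mul]
            exact mul_le_mul_of_nonneg_right (hPR (Sum.inr e)) (abs_nonneg _)
        _ = Real.exp (-(1 + ε) * s) * (S⁻¹ * ∑ e, |b (Sum.inr e) i|) := by
            rw [← Finset.mul_sum, mul_assoc]
        _ < Real.exp (-(1 + ε) * s) * 1 := by
            refine mul_lt_mul_of_pos_left ?_ (Real.exp_pos _)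
            rw [inv_mul_lt_iff₀ hS0, mul_one, hS]
            have := Finset.single_le_sum (f := fun i => ∑ e, |b (Sum.inr e) i|)
              (fun i _ => Finset.sum_nonneg fun e _ => abs_nonneg _) (Finset.mem_univ i)
            linarith
        _ = Real.exp (-(1 + ε) * s) := mul_one _
    exact absurd hi (not_le.2 hlt')
  have hlim : ∑ j, τ j ≤ Fintype.card E := by
    refine le_of_forall_pos_le_add fun d hd => ?_
    refine (key (d / (Fintype.card E + 1)) (by positivity)).trans ?_
    have : d / (Fintype.card E + 1) * Fintype.card E ≤ d := by
      rw [div_mul_eq_mul_div, div_le_iff₀ (by positivity)]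
      nlinarith
    linarith
  rw [← hcard]
  push_cast
  linarith

/-! ### Linear independence and approximation of vectors -/

theorem theorem4 (k p : ℕ) (hk : 1 ≤ k) (hp : 1 ≤ p)
    (C : Fin p → (Fin k → ℝ))
    (τ ω φ : Fin k → ℝ)
    (hτ_pos : ∀ j, 0 < τ j) (hτ_inj : Function.Injective τ)
    (hωφ : {n : ℤ | ∀ j, ¬ ((n : ℝ) * ω j + φ j ≡ Real.pi / 2 [PMOD Real.pi])}.Infinite)
    (Q : ℕ → ℕ) (hQ_pos : ∀ n, 1 ≤ n → 0 < Q n) (hQ_mono : StrictMonoOn Q (Set.Ici 1))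
    (hQ_growth :
      (∃ u : ℕ → ℝ, u =O[atTop] (fun n : ℕ => 1 / (n : ℝ)) ∧
          ∀ᶠ n in atTop, (Q (n + 1) : ℝ) = (Q n : ℝ) ^ (1 + u n)) ∨
      ((∀ j, ω j = 0) ∧
        ∃ u : ℕ → ℝ, Tendsto u atTop (𝓝 0) ∧
          ∀ᶠ n in atTop, (Q (n + 1) : ℝ) = (Q n : ℝ) ^ (1 + u n)))
    (ℓ : Fin p → ℕ → ℤ)
    (hℓ_bound : ∃ u : ℕ → ℝ, Tendsto u atTop (𝓝 0) ∧
      ∀ᶠ n in atTop, ∀ i, |(ℓ i n : ℝ)| ≤ (Q n : ℝ) ^ (1 + u n))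
    (hℓ_small : ∀ j, ∃ a b : ℕ → ℝ, Tendsto a atTop (𝓝 0) ∧ Tendsto b atTop (𝓝 0) ∧
      ∀ᶠ n in atTop,
        (∑ i, (ℓ i n : ℝ) • C i) j =
            (Q n : ℝ) ^ (-τ j + a n) * (Real.cos ((n : ℝ) * ω j + φ j) + b n) ∨
        (∑ i, (ℓ i n : ℝ) • C i) j =
            -((Q n : ℝ) ^ (-τ j + a n) * (Real.cos ((n : ℝ) * ω j + φ j) + b n))) :
    ((k : ℝ) + ∑ j, τ j ≤ (Module.finrank ℚ (Submodule.span ℚ (Set.range C)) : ℝ)) ∧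
    (∀ χ : (Fin k → ℝ) →ₗ[ℝ] ℝ, χ ≠ 0 → ∃ i, Irrational (χ (C i))) ∧
    (∀ ε : ℝ, 0 < ε → ∃ Q₀ : ℝ, ∀ T : ℝ, Q₀ ≤ T →
      ∀ lam : Fin k → ℝ, lam ≠ 0 → (∀ j, |lam j| ≤ T ^ τ j) →
        T ^ (-1 - ε) ≤
          Metric.infDist
            (WithLp.toLp 2 (fun i => ∑ j, lam j * C i j) : EuclideanSpace ℝ (Fin p))
            (nonzeroIntPoints p)) := by
  have hgrowth : ∃ u : ℕ → ℝ, Tendsto u atTop (𝓝 0) ∧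
      ∀ᶠ n in atTop, (Q (n + 1) : ℝ) = (Q n : ℝ) ^ (1 + u n) := by
    rcases hQ_growth with ⟨u, hu, huQ⟩ | ⟨-, h⟩
    · exact ⟨u, hu.trans_tendsto tendsto_one_div_atTop_nhds_zero_nat, huQ⟩
    · exact h
  obtain ⟨n₀, hn₀⟩ := hωφ.nonempty
  have hcos : ∀ j, Real.cos (n₀ * ω j + φ j) ≠ 0 := by
    intro j
    rw [Real.cos_ne_zero_iff]
    intro m hm
    refine hn₀ j (AddCommGroup.modEq_iff_zsmul.2 ⟨-m, ?_⟩)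
    rw [hm, zsmul_eq_mul]
    push_cast
    ring
  have H : HasSmallForms C τ := by
    refine hasSmallForms_of_oscillating hτ_pos hcos hQ_pos hQ_mono hgrowth hℓ_bound fun j => ?_
    obtain ⟨a, b, ha, hb, hab⟩ := hℓ_small j
    refine ⟨a, b, ha, hb, hab.mono fun n hn => ?_⟩
    simp only [Finset.sum_apply, Pi.smul_apply, smul_eq_mul] at hn
    rcases hn with hn | hn
    · rw [hn, abs_mul, abs_of_nonneg (Real.rpow_nonneg (Nat.cast_nonneg _) _)]
    · rw [hn, abs_neg, abs_mul, abs_of_nonneg (Real.rpow_nonneg (Nat.cast_nonneg _) _)]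
  refine ⟨?_, fun χ hχ => ?_, fun ε hε => ?_⟩
  · obtain ⟨D, A, hA⟩ := exists_fin_finrank_int_combinations C
    simpa only [Fintype.card_fin] using
      (H.of_int_combinations A hA).card_add_sum_le hτ_pos hτ_inj
  · by_contra! hrat
    have hrat' : ∀ i, ∃ r : ℚ, (r : ℝ) = χ (C i) := fun i => not_not.1 (hrat i)
    choose r hr using hrat'
    -- Multiplying by a common denominator makes all values of `χ` integral.
    set N : ℕ := ∏ i, (r i).den with hN
    have hN0 : (N : ℝ) ≠ 0 := by
      exact_mod_cast Finset.prod_ne_zero_iff.2 fun i _ => (r i).den_nz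
    have hχC : ∀ x : Fin k → ℝ, χ x = ∑ j, χ (Pi.single j 1) * x j := by
      intro x
      rw [LinearMap.pi_apply_eq_sum_univ χ x]
      refine Finset.sum_congr rfl fun j _ => ?_
      rw [smul_eq_mul, mul_comm]
      congr 2
      ext i
      simp [Pi.single_apply, eq_comm]
    have hlam : (fun j => N * χ (Pi.single j 1)) ≠ 0 := by
      intro h
      refine hχ (LinearMap.ext fun x => ?_)
      have h' : ∀ j, χ (Pi.single j 1) = 0 := fun j =>
        (mul_eq_zero.1 (congrFun h j)).resolve_left hN0
      rw [hχC]
      simp [h']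
    have hint : ∀ i, ∃ m : ℤ, N * χ (C i) = m := by
      intro i
      obtain ⟨d, hd⟩ : (r i).den ∣ N := Finset.dvd_prod_of_mem _ (Finset.mem_univ i)
      refine ⟨d * (r i).num, ?_⟩
      have h1 : ((r i).den : ℝ) * (r i : ℝ) = (r i).num := by
        exact_mod_cast Rat.den_mul_eq_num (r i)
      rw [← hr, hd]
      push_cast
      rw [← h1]
      ring
    choose P hP using hint
    obtain ⟨i, hi⟩ := H.exists_ne_intCast hτ_pos hτ_inj hlam P
    refine hi ?_
    rw [← hP, hχC, Finset.mul_sum]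
    exact Finset.sum_congr rfl fun j _ => mul_assoc _ _ _
  · obtain ⟨s₀, hs₀⟩ := eventually_atTop.1 (H.eventually_le hτ_pos hτ_inj hε)
    refine ⟨Real.exp s₀, fun T hT lam _ hlamT => ?_⟩
    have hT0 : 0 < T := (Real.exp_pos _).trans_le hT
    have hrpow : ∀ y, T ^ y = Real.exp (y * Real.log T) := fun y => by
      rw [Real.rpow_def_of_pos hT0, mul_comm]
    simp only [hrpow] at hlamT ⊢
    have hne : (nonzeroIntPoints p).Nonempty := by
      refine ⟨WithLp.toLp 2 fun _ => 1, fun h => ?_, fun i => ⟨1, by simp⟩⟩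
      have := congrArg (fun y : EuclideanSpace ℝ (Fin p) => y ⟨0, hp⟩) h
      simp at this
    rw [Metric.le_infDist hne]
    rintro y ⟨hy0, hy⟩
    choose P hP using hy
    have hP0 : P ≠ 0 := by
      rintro rfl
      exact hy0 (by ext i; simpa using hP i)
    obtain ⟨i, hi⟩ := hs₀ (Real.log T) ((Real.le_log_iff_exp_le hT0).2 hT) lam hlamT P hP0
    rw [dist_comm, dist_eq_norm]
    refine le_trans ?_ (PiLp.norm_apply_le _ i)
    rw [PiLp.sub_apply, hP, Real.norm_eq_abs]
    refine le_trans (Real.exp_le_exp.2 (le_of_eq ?_)) hi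
    ring
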